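/- **Theorem.** Consider the Node Congested Clique with $n\ge 1$ nodes, which have distinct identifiers $1,\dots,n$ (known to the nodes, as is $n$). Computation proceeds in synchronous rounds with unrestricted local computation; in one round each ordered pair of nodes can exchange at most one message, each message has $O(\log n)$ bits, and each node sends at most $O(\log n)$ and receives at most $O(\log n)$ messages. In the routing problem, every node holds a list of messages, each consisting of a destination node and a content (a bit string); initially only the source of a message knows its destination and content, and at the end every node must know exactly the messages addressed to it (source and content, with multiplicity). The routing problem in which every node is the source of $O(\log n)$ and the destination of $O(\log n)$ messages of $O(\log n)$ bits can be solved deterministically in $O(1)$ rounds. Precisely: for all real constants $a>0$, $A$, $b$, $c$ there are constants $R,K\in\mathbb N$ such that for all $n\ge 1$ and all natural numbers $\alpha,q,m$ with $a\log n\le\alpha\le A\log n$, $q\le c\,\alpha$ and $m\le b\log n$ there is a deterministic protocol for $n$ nodes which, on every instance where each node is the source of at most $q$ messages and the destination of at most $q$ messages, each of at most $m$ bits, delivers all messages to their destinations within $R$ rounds, such that in every round each ordered pair of nodes exchanges at most one message, every transmitted message has at most $K\log n$ bits, and every node sends at most $\max(\alpha,q)$ and receives at most $\max(\alpha,q)$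 messages. (In particular, if each node is the source and destination of at most $\alpha$ messages, then at most $\alpha$ messages per node and round are sent and received.) -/

import Mathlib

namespace NCC

/-- A deterministic synchronous message-passing algorithm for `n` nodes, whose identifiers are the
elements of `Fin n`. Local computation is unrestricted. There is one link for every ordered pair of
nodes, and it carries at most one bit string per round (`none` means that nothing is sent).

* `init v l` is the initial state of node `v` when its own part of the input is the list `l` of
  pairs (destination, content), so that a node knows at the start nothing about the messages of the
  other nodes;
* `send x v` is what a node in state `x` transmits to node `v` in the coming round;
* `recv x r` is the next state of a node in state `x` which receives `r u` from each node `u`;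
* `output x` is the collection of pairs (source, content) that a node in state `x` has learnt. -/
structure Protocol (n : ℕ) where
  State : Type
  init : Fin n → List (Fin n × List Bool) → State
  send : State → Fin n → Option (List Bool)
  recv : State → (Fin n → Option (List Bool)) → State
  output : State → Multiset (Fin n × List Bool)

/-- An instance of the routing problem: every node holds a list of messages, each given by its
destination and its content. -/
abbrev Instance (n : ℕ) : Type := Fin n → List (Fin n × List Bool)

/-- The messages with destination `v`, as pairs (source, content), with multiplicity. -/
def Instance.addressedTo {n : ℕ} (I : Instance n) (v : Fin n) : Multiset (Fin n × List Bool) :=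
  ∑ u : Fin n, (((I u).filter (fun p => p.1 = v)).map (fun p => (u, p.2)) :
    Multiset (Fin n × List Bool))

/-- Every node is the source of at most `q` messages and the destination of at most `q` messages,
and every message has at most `m` bits. -/
def Instance.Admissible {n : ℕ} (I : Instance n) (q m : ℕ) : Prop :=
  (∀ v, (I v).length ≤ q) ∧ (∀ v, Multiset.card (I.addressedTo v) ≤ q) ∧
    ∀ v, ∀ p ∈ I v, p.2.length ≤ m

namespace Protocol

variable {n : ℕ}

/-- The states of all nodes after `t` rounds of `P` on the instance `I`. -/
def stateAfter (P : Protocol n) (I : Instance n) : ℕ → Fin n → P.State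
  | 0 => fun v => P.init v (I v)
  | t + 1 => fun v =>
      P.recv (P.stateAfter I t v) (fun u => P.send (P.stateAfter I t u) v)

/-- What `u` transmits to `v` in round number `t` (rounds are numbered from `0`). -/
def transmitted (P : Protocol n) (I : Instance n) (t : ℕ) (u v : Fin n) : Option (List Bool) :=
  P.send (P.stateAfter I t u) v

/-- During the first `R` rounds on the instance `I`, each node sends at most `cap` and receives at
most `cap` transmissions per round, and each transmission has at most `bits` bits. -/
def RespectsLimits (P : Protocol n) (I : Instance n) (R cap : ℕ) (bits : ℝ) : Prop :=
  ∀ t < R,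
    (∀ u, (Finset.univ.filter fun v => (P.transmitted I t u v).isSome).card ≤ cap) ∧
    (∀ v, (Finset.univ.filter fun u => (P.transmitted I t u v).isSome).card ≤ cap) ∧
    ∀ u v, ∀ w ∈ P.transmitted I t u v, (w.length : ℝ) ≤ bits

/-- After `R` rounds on the instance `I`, every node has learnt exactly the messages addressed
to it. -/
def Delivers (P : Protocol n) (I : Instance n) (R : ℕ) : Prop :=
  ∀ v, P.output (P.stateAfter I R v) = I.addressedTo v

end Protocol

end NCC

/-! Put L = max(α, q) and cut the nodes into groups of size between min(n, L)/2 and L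
(`exists_groups`). A node can address its whole group in one round, and q is at most a constant C
times the size of any group. Exchanging counts and offsets with the destinations takes two rounds
and numbers the messages to each destination. Every message thus gets a label in `Fin q`, and
messages with a common destination have different labels. Hence one node can deliver a bundle of
messages with equal labels in a single round, and only the gathering of such bundles inside each
group remains.

A multiset of at most q labels fits into O(q) bits (`card_labels_le`), so after one more round each
group knows all its labels, and its members compute the same plan (`exists_isPlan`). The plan moves
each message from source to relay to target inside the group, using D = 3C time slices, each with
one place per node. Bundles of about half the group size leave enough freedom to choose the relays
greedily (`exists_greedy`). With the final leg this gives 3 + 3D = 9C + 3 rounds.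

The schedule is defined from the whole instance. `exists_protocol` turns it into an algorithm once
each transmission is seen to depend only on the view of its sender (`schedule_eq_some_of_eq`). -/

namespace NCC

open Finset

/-! ### Chunks and greedy colouring -/

section Combinatorics

variable {α β : Type*}

/-- The number of elements of `X` in the fibre of `f` through `x` that come before `x` in the order
given by `e`. -/
def fiberRank [DecidableEq β] (X : Finset α) (e : α → ℕ) (f : α → β) (x : α) : ℕ :=
  #{y ∈ X | e y < e x ∧ f y = f x}

theorem fiberRank_lt_card [DecidableEq β] {X : Finset α} {e : α → ℕ} {f : α → β} {x : α}
    (hx : x ∈ X) : fiberRank X e f x < #{y ∈ X | f y = f x} := by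
  refine Finset.card_lt_card ?_
  rw [Finset.ssubset_iff_of_subset]
  · exact ⟨x, by simp [hx], by simp⟩
  · intro y
    simp +contextual

theorem fiberRank_lt_fiberRank [DecidableEq β] {X : Finset α} {e : α → ℕ} {f : α → β} {x y : α}
    (hx : x ∈ X) (hf : f x = f y) (h : e x < e y) : fiberRank X e f x < fiberRank X e f y := by
  refine Finset.card_lt_card ?_
  rw [Finset.ssubset_iff_of_subset]
  · exact ⟨x, by simp [hx, hf, h], by simp⟩
  · intro z hz
    simp only [Finset.mem_filter] at hz ⊢
    exact ⟨hz.1, hz.2.1.trans h, hz.2.2.trans hf⟩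

theorem eq_of_fiberRank_eq [DecidableEq β] {X : Finset α} {e : α → ℕ} {f : α → β} {x y : α}
    (he : Function.Injective e) (hx : x ∈ X) (hy : y ∈ X) (hf : f x = f y)
    (h : fiberRank X e f x = fiberRank X e f y) : x = y := by
  rcases lt_trichotomy (e x) (e y) with h' | h' | h'
  · exact absurd h (fiberRank_lt_fiberRank hx hf h').ne
  · exact he h'
  · exact absurd h (fiberRank_lt_fiberRank hy hf.symm h').ne'

/-- A labelled finite set can be cut into few chunks of bounded size with constant label. -/
theorem exists_chunks {q : ℕ} [Nonempty β] [DecidableEq β] (X : Finset α) (e : α → ℕ)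
    (he : Function.Injective e)
    (lab : α → Fin q) {f : ℕ} (hf : 0 < f) (Y : Finset β) (h : #X / f + q ≤ #Y) :
    ∃ y : α → β, (∀ x ∈ X, y x ∈ Y) ∧ (∀ b, #{x ∈ X | y x = b} ≤ f) ∧
      ∀ x ∈ X, ∀ x' ∈ X, y x = y x' → lab x = lab x' := by
  classical
  let N : Fin q → ℕ := fun i => #{x ∈ X | lab x = i}
  -- Chunk names: each label class is cut into rank intervals of length `f`. Rounding costs at most
  -- one extra chunk per label, hence the summand `q`.
  let Z : Finset (Fin q × ℕ) :=
    (univ : Finset (Fin q)).biUnion fun i => (range (N i / f + 1)).image fun r => (i, r)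
  have hN : ∑ i, N i = #X := (Finset.card_eq_sum_card_fiberwise (fun _ _ => mem_univ _)).symm
  have hZ : #Z ≤ #Y := by
    calc #Z ≤ ∑ i : Fin q, (N i / f + 1) := by
          refine card_biUnion_le.trans (sum_le_sum fun i _ => ?_)
          exact card_image_le.trans (by simp)
      _ = ∑ i : Fin q, N i / f + q := by simp [sum_add_distrib]
      _ ≤ #X / f + q := by
          gcongr
          rw [Nat.le_div_iff_mul_le hf, sum_mul, ← hN]
          exact sum_le_sum fun i _ => Nat.div_mul_le_self _ _
      _ ≤ #Y := h
  obtain ⟨g⟩ : Nonempty (Z ↪ Y) := Function.Embedding.nonempty_of_card_le (by simpa using hZ)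
  let z : α → Fin q × ℕ := fun x => (lab x, fiberRank X e lab x / f)
  have hz : ∀ x ∈ X, z x ∈ Z := by
    intro x hx
    simp only [Z, mem_biUnion, mem_univ, true_and, mem_image, mem_range]
    exact ⟨lab x, _, Nat.lt_succ_of_le (Nat.div_le_div_right (fiberRank_lt_card hx).le), rfl⟩
  let y : α → β := fun x => if hx : z x ∈ Z then (g ⟨z x, hx⟩ : β) else Classical.arbitrary β
  have hy : ∀ x ∈ X, ∀ x' ∈ X, y x = y x' → z x = z x' := by
    intro x hx x' hx' hxx
    simp only [y, hz x hx, hz x' hx', dif_pos] at hxx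
    exact congrArg Subtype.val (g.injective (Subtype.ext hxx))
  refine ⟨y, fun x hx => ?_, fun b => ?_, fun x hx x' hx' hxx => congrArg Prod.fst (hy x hx x' hx' hxx)⟩
  · simp only [y, hz x hx, dif_pos]
    exact (g _).2
  · rcases Finset.eq_empty_or_nonempty {x ∈ X | y x = b} with h0 | ⟨x₀, hx₀⟩
    · simp [h0]
    rw [mem_filter] at hx₀
    have hsub : ∀ x ∈ ({x ∈ X | y x = b} : Finset α), z x = z x₀ := by
      intro x hx
      rw [mem_filter] at hx
      exact hy x hx.1 x₀ hx₀.1 (hx.2.trans hx₀.2.symm)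
    calc #{x ∈ X | y x = b}
        ≤ #(Ico ((z x₀).2 * f) (((z x₀).2 + 1) * f)) := by
          refine card_le_card_of_injOn (fiberRank X e lab) ?_ ?_
          · intro x hx
            have h1 := congrArg Prod.snd (hsub x hx)
            rw [coe_Ico, Set.mem_Ico, ← h1]
            exact ⟨Nat.div_mul_le_self _ _, Nat.lt_mul_of_div_lt (Nat.lt_succ_self _) hf⟩
          · intro x hx x' hx' hr
            have h1 := congrArg Prod.fst ((hsub x hx).trans (hsub x' hx').symm)
            exact eq_of_fiberRank_eq he (mem_filter.1 hx).1 (mem_filter.1 hx').1 h1 hr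
      _ = f := by simp [Nat.add_mul]

/-- Greedy colouring with colours in `range D ×ˢ G`: elements in the same fibre of `row` get
different colours, and elements in the same fibre of `y` get colours with different second
components. -/
theorem exists_greedy {γ δ κ : Type*} [DecidableEq γ] [DecidableEq δ] [DecidableEq κ] [Nonempty κ]
    (X : Finset α) (row : α → γ) (y : α → δ) (G : Finset κ) {D q f : ℕ}
    (hrow : ∀ u, #{x ∈ X | row x = u} ≤ q) (hy : ∀ z, #{x ∈ X | y x = z} ≤ f)
    (h : q - 1 + (f - 1) * D < D * #G) :
    ∃ col : α → ℕ × κ, (∀ x ∈ X, (col x).1 < D ∧ (col x).2 ∈ G) ∧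
      (∀ x ∈ X, ∀ x' ∈ X, row x = row x' → col x = col x' → x = x') ∧
      ∀ x ∈ X, ∀ x' ∈ X, (col x).2 = (col x').2 → y x = y x' → x = x' := by
  classical
  induction X using Finset.induction_on with
  | empty => exact ⟨fun _ => (0, Classical.arbitrary κ), by simp⟩
  | insert a X ha ih =>
    obtain ⟨col, h1, h2, h3⟩ := ih
      (fun u => (card_le_card (filter_subset_filter _ (subset_insert a X))).trans (hrow u))
      (fun u => (card_le_card (filter_subset_filter _ (subset_insert a X))).trans (hy u))
    have hr : #{x ∈ X | row x = row a} ≤ q - 1 := by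
      have := hrow (row a)
      rw [filter_insert, if_pos rfl, card_insert_of_notMem (by simp [ha])] at this
      omega
    have hf : #{x ∈ X | y x = y a} ≤ f - 1 := by
      have := hy (y a)
      rw [filter_insert, if_pos rfl, card_insert_of_notMem (by simp [ha])] at this
      omega
    -- Colours forbidden for `a`: the single colours used in its row, and all `D` colours over each
    -- second component used in its `y`-class.
    let F : Finset (ℕ × κ) := ({x ∈ X | row x = row a} : Finset α).image col ∪
      ({x ∈ X | y x = y a} : Finset α).biUnion fun x => range D ×ˢ {(col x).2}
    have hF : #F < #(range D ×ˢ G) := by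
      calc #F ≤ (q - 1) + (f - 1) * D := by
            refine (card_union_le _ _).trans (add_le_add (card_image_le.trans hr) ?_)
            refine (card_biUnion_le_card_mul _ _ D fun x _ => by simp).trans ?_
            gcongr
        _ < _ := by simpa using h
    obtain ⟨c, hc, hcF⟩ := exists_mem_notMem_of_card_lt_card hF
    rw [mem_product, mem_range] at hc
    have hcr : ∀ x ∈ X, row x = row a → col x ≠ c := by
      rintro x hx hxa rfl
      exact hcF (mem_union_left _ (mem_image_of_mem _ (by simp [hx, hxa])))
    have hcy : ∀ x ∈ X, y x = y a → (col x).2 ≠ c.2 := by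
      intro x hx hxa hxc
      refine hcF (mem_union_right _ (mem_biUnion.2 ⟨x, by simp [hx, hxa], ?_⟩))
      rw [mem_product, mem_range, mem_singleton]
      exact ⟨hc.1, hxc.symm⟩
    have hne : ∀ x ∈ X, x ≠ a := fun x hx hxa => ha (hxa ▸ hx)
    refine ⟨Function.update col a c, ?_, ?_, ?_⟩
    · intro x hx
      rcases mem_insert.1 hx with rfl | hx
      · simpa using hc
      · rw [Function.update_of_ne (hne x hx)]
        exact h1 x hx
    · intro x hx x' hx' hxx hcc
      rcases mem_insert.1 hx with rfl | hxX <;> rcases mem_insert.1 hx' with rfl | hxX'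
      · rfl
      · rw [Function.update_self, Function.update_of_ne (hne x' hxX')] at hcc
        exact absurd hcc.symm (hcr x' hxX' hxx.symm)
      · rw [Function.update_self, Function.update_of_ne (hne x hxX)] at hcc
        exact absurd hcc (hcr x hxX hxx)
      · rw [Function.update_of_ne (hne x hxX), Function.update_of_ne (hne x' hxX')] at hcc
        exact h2 x hxX x' hxX' hxx hcc
    · intro x hx x' hx' hcc hxx
      rcases mem_insert.1 hx with rfl | hxX <;> rcases mem_insert.1 hx' with rfl | hxX'
      · rfl
      · rw [Function.update_self, Function.update_of_ne (hne x' hxX')] at hcc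
        exact absurd hcc.symm (hcy x' hxX' hxx.symm)
      · rw [Function.update_self, Function.update_of_ne (hne x hxX)] at hcc
        exact absurd hcc (hcy x hxX hxx)
      · rw [Function.update_of_ne (hne x hxX), Function.update_of_ne (hne x' hxX')] at hcc
        exact h3 x hxX x' hxX' hcc hxx

end Combinatorics

/-! ### Plans inside one group -/

/-- A place for one message in a group: its source, its label, and its rank among the messages with
the same source and label. -/
abbrev Slot (n q : ℕ) : Type := Fin n × Fin q × ℕ

/-- A relay and a final holder in the group `G`, each with one of `D` time slices, for all slots in
`X`. -/
structure IsPlan {n q : ℕ} (G : Finset (Fin n)) (D : ℕ) (X : Finset (Slot n q))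
    (relay target : Slot n q → ℕ × Fin n) : Prop where
  relay_mem : ∀ x ∈ X, (relay x).1 < D ∧ (relay x).2 ∈ G
  target_mem : ∀ x ∈ X, (target x).1 < D ∧ (target x).2 ∈ G
  relay_inj : ∀ x ∈ X, ∀ x' ∈ X, x.1 = x'.1 → relay x = relay x' → x = x'
  pair_inj : ∀ x ∈ X, ∀ x' ∈ X, (relay x).2 = (relay x').2 → target x = target x' → x = x'
  label_eq : ∀ x ∈ X, ∀ x' ∈ X, target x = target x' → x.2.1 = x'.2.1
  card_le : ∀ z, #{x ∈ X | target x = z} ≤ #G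

/-- Targets are chunks of size at most f = ⌈#G/2⌉. There are at most 2q + q ≤ 3C·#G of them, which
is where 3C slices come from. Relays are greedy colours: the same-target condition forbids fewer
than half of the 3C·#G colours, and the same-source condition fewer than a third. -/
theorem exists_isPlan {n q C : ℕ} (G : Finset (Fin n)) (hG : G.Nonempty) (hC : 0 < C)
    (hq : q ≤ C * #G) (X : Finset (Slot n q)) (hX : ∀ x ∈ X, x.1 ∈ G)
    (hrow : ∀ u, #{x ∈ X | x.1 = u} ≤ q) :
    ∃ p : (Slot n q → ℕ × Fin n) × (Slot n q → ℕ × Fin n), IsPlan G (3 * C) X p.1 p.2 := by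
  have : Nonempty (Fin n) := ⟨hG.choose⟩
  have hs : 0 < #G := hG.card_pos
  have hcard : #X ≤ q * #G :=
    card_le_mul_card_image_of_maps_to hX q fun u _ => hrow u
  have hCs : 0 < C * #G := Nat.mul_pos hC hs
  set f := (#G + 1) / 2 with hf
  have hf0 : 0 < f := by omega
  have hdiv : #X / f ≤ 2 * q := by
    refine Nat.div_le_of_le_mul (hcard.trans ?_)
    calc q * #G ≤ q * (2 * f) := by gcongr; omega
      _ = f * (2 * q) := by ring
  obtain ⟨y, hy1, hy2, hy3⟩ := exists_chunks X Encodable.encode Encodable.encode_injective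
    (fun x => x.2.1) hf0 (range (3 * C) ×ˢ G) (by
      rw [card_product, card_range, mul_assoc]
      omega)
  obtain ⟨col, hc1, hc2, hc3⟩ := exists_greedy X (fun x => x.1) y G (D := 3 * C) hrow hy2 (by
    have h1 : 2 * ((f - 1) * (3 * C)) ≤ 3 * (C * #G) := by
      calc 2 * ((f - 1) * (3 * C)) = (2 * (f - 1)) * (3 * C) := by ring
        _ ≤ #G * (3 * C) := by gcongr; omega
        _ = 3 * (C * #G) := by ring
    rw [mul_assoc 3 C]
    omega)
  refine ⟨(col, y), hc1, fun x hx => ?_, hc2, hc3, hy3, fun z => (hy2 z).trans (by omega)⟩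
  simpa using hy1 x hx

/-! ### Partition into groups -/

/-- The nodes can be partitioned into groups of nearly equal size. -/
theorem exists_groups (n L : ℕ) (hL : 0 < L) :
    ∃ gr : Fin n → ℕ, ∀ u, #{w | gr w = gr u} ≤ L ∧ min n L ≤ 2 * #{w | gr w = gr u} := by
  set g := (L + 1) / 2 with hg
  have hg0 : 0 < g := by omega
  -- Blocks of g = ⌈L/2⌉ consecutive nodes, the last one absorbing the remainder, so that it has at
  -- most 2g - 1 ≤ L nodes. If n < g, truncated subtraction makes a single group.
  refine ⟨fun i => min (i / g) (n / g - 1), fun u => ?_⟩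
  have hcard : ∀ a b : ℕ, b ≤ n → #{w : Fin n | a ≤ (w : ℕ) ∧ (w : ℕ) < b} = b - a := by
    intro a b hb
    rw [← Nat.card_Ico, ← card_map Fin.valEmbedding]
    congr 1
    ext i
    simp only [mem_map, mem_filter, mem_univ, true_and, Fin.valEmbedding_apply, mem_Ico]
    exact ⟨by rintro ⟨w, hw, rfl⟩; exact hw, fun hi => ⟨⟨i, by omega⟩, hi, rfl⟩⟩
  beta_reduce
  set k := min ((u : ℕ) / g) (n / g - 1) with hk
  have hn := Nat.div_add_mod n g
  have hm := Nat.mod_lt n hg0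
  have hun : (u : ℕ) / g ≤ n / g := Nat.div_le_div_right u.2.le
  rcases Nat.eq_zero_or_pos (n / g) with h0 | h0
  · rw [h0, mul_zero, zero_add] at hn
    have : #{w : Fin n | min ((w : ℕ) / g) (n / g - 1) = k} = n := by
      rw [filter_true_of_mem]
      · simp
      · intro w _
        simp [hk, h0]
    omega
  have hkn : k + 1 ≤ n / g := by omega
  have hle : k * g + g ≤ n := by
    calc k * g + g = g * (k + 1) := by ring
      _ ≤ g * (n / g) := by gcongr
      _ ≤ n := by omega
  have hgr : ∀ w : Fin n, k * g ≤ (w : ℕ) → (w : ℕ) < k * g + g →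
      min ((w : ℕ) / g) (n / g - 1) = k := by
    intro w h1 h2
    have : (w : ℕ) / g = k := by
      rw [Nat.div_eq_iff hg0]
      omega
    omega
  constructor
  · by_cases hlast : k = n / g - 1
    · calc #{w : Fin n | min ((w : ℕ) / g) (n / g - 1) = k}
          ≤ #{w : Fin n | k * g ≤ (w : ℕ) ∧ (w : ℕ) < n} := by
            refine card_le_card fun w hw => ?_
            simp only [mem_filter, mem_univ, true_and] at hw ⊢
            refine ⟨?_, w.2⟩
            have : k ≤ (w : ℕ) / g := by omega
            exact (Nat.le_div_iff_mul_le hg0).1 this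
        _ = n - k * g := hcard _ _ le_rfl
        _ ≤ L := by
            have : g * (n / g) = k * g + g := by
              rw [show n / g = k + 1 by omega]; ring
            omega
    · calc #{w : Fin n | min ((w : ℕ) / g) (n / g - 1) = k}
          ≤ #{w : Fin n | k * g ≤ (w : ℕ) ∧ (w : ℕ) < k * g + g} := by
            refine card_le_card fun w hw => ?_
            simp only [mem_filter, mem_univ, true_and] at hw ⊢
            have h1 : (w : ℕ) / g = k := by omega
            rw [Nat.div_eq_iff hg0] at h1
            omega
        _ = g := by rw [hcard _ _ hle]; omega
        _ ≤ L := by omega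
  · have : g ≤ #{w : Fin n | min ((w : ℕ) / g) (n / g - 1) = k} := by
      calc g = #{w : Fin n | k * g ≤ (w : ℕ) ∧ (w : ℕ) < k * g + g} := by
            rw [hcard _ _ hle]; omega
        _ ≤ _ := by
            refine card_le_card fun w hw => ?_
            simp only [mem_filter, mem_univ, true_and] at hw ⊢
            exact hgr w hw.1 hw.2
    omega

/-! ### From schedules to protocols -/

/-- A transmission schedule in which every node transmits and learns only what is determined by its
input and the transmissions it has received before is carried out by a protocol. -/
theorem exists_protocol {n : ℕ} (adm : Instance n → Prop) (R : ℕ)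
    (tr : Instance n → ℕ → Fin n → Fin n → Option (List Bool))
    (hloc : ∀ I I', adm I → adm I' → ∀ t < R, ∀ u, I u = I' u →
      (∀ t' < t, ∀ w, tr I t' w u = tr I' t' w u) → ∀ v, tr I t u v = tr I' t u v)
    (hout : ∀ I I', adm I → adm I' → ∀ v, I v = I' v →
      (∀ t < R, ∀ w, tr I t w v = tr I' t w v) → I.addressedTo v = I'.addressedTo v) :
    ∃ P : Protocol n, ∀ I, adm I →
      (∀ t < R, ∀ u v, P.transmitted I t u v = tr I t u v) ∧ P.Delivers I R := by
  classical
  let St : Type := Fin n × List (Fin n × List Bool) × ℕ × (ℕ → Fin n → Option (List Bool))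
  -- The state is the complete view of a node. A node acts as it would in any admissible instance
  -- consistent with its view. The actual instance is always one, and by locality the choice does
  -- not matter.
  let Con : St → Instance n → Prop := fun x I =>
    adm I ∧ I x.1 = x.2.1 ∧ ∀ t < x.2.2.1, ∀ w, tr I t w x.1 = x.2.2.2 t w
  let P : Protocol n :=
    { State := St
      init := fun v l => (v, l, 0, fun _ _ => none)
      send := fun x w => if h : ∃ I, Con x I then tr h.choose x.2.2.1 x.1 w else none
      recv := fun x r => (x.1, x.2.1, x.2.2.1 + 1, Function.update x.2.2.2 x.2.2.1 r)
      output := fun x => if h : ∃ I, Con x I then h.choose.addressedTo x.1 else 0 }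
  have hinv : ∀ I, adm I → ∀ t ≤ R, ∀ v, ∃ h : ℕ → Fin n → Option (List Bool),
      (∀ t' < t, ∀ w, tr I t' w v = h t' w) ∧ P.stateAfter I t v = (v, I v, t, h) := by
    intro I hI t
    induction t with
    | zero => exact fun _ v => ⟨fun _ _ => none, by simp, rfl⟩
    | succ t ih =>
      intro ht v
      obtain ⟨h, hh, hst⟩ := ih (by omega) v
      have hsend : ∀ u w, P.send (P.stateAfter I t u) w = tr I t u w := by
        intro u w
        obtain ⟨k, hk, hsu⟩ := ih (by omega) u
        have hex : ∃ J, Con (u, I u, t, k) J := ⟨I, hI, rfl, hk⟩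
        have hJ := hex.choose_spec
        rw [hsu]
        simp only [P, dif_pos hex]
        exact hloc _ _ hJ.1 hI t (by omega) u hJ.2.1
          (fun t' ht' w => (hJ.2.2 t' ht' w).trans (hk t' ht' w).symm) w
      refine ⟨Function.update h t fun u => tr I t u v, ?_, ?_⟩
      · intro t' ht' w
        rcases Nat.lt_succ_iff_lt_or_eq.1 ht' with h' | rfl
        · rw [Function.update_of_ne h'.ne]
          exact hh t' h' w
        · rw [Function.update_self]
      · change P.recv (P.stateAfter I t v) (fun u => P.send (P.stateAfter I t u) v) = _
        simp only [hsend, hst]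
        rfl
  refine ⟨P, fun I hI => ⟨fun t ht u v => ?_, fun v => ?_⟩⟩
  · obtain ⟨k, hk, hsu⟩ := hinv I hI t ht.le u
    have hex : ∃ J, Con (u, I u, t, k) J := ⟨I, hI, rfl, hk⟩
    have hJ := hex.choose_spec
    rw [Protocol.transmitted, hsu]
    simp only [P, dif_pos hex]
    exact hloc _ _ hJ.1 hI t ht u hJ.2.1
      (fun t' ht' w => (hJ.2.2 t' ht' w).trans (hk t' ht' w).symm) v
  · obtain ⟨k, hk, hsu⟩ := hinv I hI R le_rfl v
    have hex : ∃ J, Con (v, I v, R, k) J := ⟨I, hI, rfl, hk⟩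
    have hJ := hex.choose_spec
    rw [hsu]
    simp only [P, dif_pos hex]
    exact hout _ _ hJ.1 hI v hJ.2.1
      (fun t' ht' w => (hJ.2.2 t' ht' w).trans (hk t' ht' w).symm)

/-! ### Binary encoding of tokens -/

/-- What is transmitted in one step of the routing algorithm: a number, a multiset of labels, or a
message with its source, destination and content. -/
inductive Token (n q : ℕ) : Type
  | num (k : ℕ) : Token n q
  | labels (M : Multiset (Fin q)) : Token n q
  | msg (u v : Fin n) (w : List Bool) : Token n q

/-- The tokens that occur in the routing of at most `q` messages with at most `m` bits per node. -/
def Token.Bounded {n q : ℕ} (m : ℕ) : Token n q → Prop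
  | num k => k ≤ q
  | labels M => Multiset.card M ≤ q
  | msg _ _ w => w.length ≤ m

theorem exists_encoding_of_card_le {U : Type*} [Fintype U] {B : ℕ} (h : Fintype.card U ≤ 2 ^ B) :
    ∃ e : U → List Bool, Function.Injective e ∧ ∀ x, (e x).length = B := by
  obtain ⟨g⟩ : Nonempty (U ↪ (Fin B → Bool)) :=
    Function.Embedding.nonempty_of_card_le (by simpa using h)
  exact ⟨fun x => List.ofFn (g x), fun x y hxy => g.injective (List.ofFn_injective hxy), by simp⟩

/-- Forgetting the order of the labels saves the logarithmic factor that a list of labels would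
cost. -/
theorem card_labels_le (q : ℕ) :
    Fintype.card (Σ k : Fin (q + 1), Sym (Fin q) (k : ℕ)) ≤ 2 ^ (3 * q) := by
  rw [Fintype.card_sigma]
  calc ∑ k : Fin (q + 1), Fintype.card (Sym (Fin q) (k : ℕ))
      ≤ ∑ _k : Fin (q + 1), 2 ^ (2 * q) := by
        refine sum_le_sum fun k _ => ?_
        rw [Sym.card_sym_eq_choose, Fintype.card_fin]
        refine (Nat.choose_le_two_pow _ _).trans (Nat.pow_le_pow_right (by norm_num) ?_)
        omega
    _ = (q + 1) * 2 ^ (2 * q) := by simp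
    _ ≤ 2 ^ q * 2 ^ (2 * q) := by
        gcongr
        exact Nat.lt_two_pow_self
    _ = 2 ^ (3 * q) := by rw [← pow_add]; congr 1; ring

theorem exists_encoding (n q m : ℕ) :
    ∃ e : Token n q → List Bool,
      (∀ x y, x.Bounded m → y.Bounded m → e x = e y → x = y) ∧
      ∀ x, (e x).length = 3 * q + 2 * m + 2 * (Nat.log 2 n + 1) + 2 := by
  classical
  -- Contents are padded with `none` to length `m`, giving 3 ^ m ≤ 4 ^ m possibilities. Each of the
  -- three summands has at most 2 ^ `E` elements, and two extra bits cover their sum.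
  let U : Type := Fin (q + 1) ⊕ (Σ k : Fin (q + 1), Sym (Fin q) (k : ℕ)) ⊕
    (Fin n × Fin n × (Fin m → Option Bool))
  let E := 3 * q + 2 * m + 2 * (Nat.log 2 n + 1)
  have hU : Fintype.card U ≤ 2 ^ (E + 2) := by
    have h1 : q + 1 ≤ 2 ^ E :=
      (Nat.lt_two_pow_self (n := q)).trans_le (Nat.pow_le_pow_right (by norm_num) (by omega))
    have h2 : Fintype.card (Σ k : Fin (q + 1), Sym (Fin q) (k : ℕ)) ≤ 2 ^ E :=
      (card_labels_le q).trans (Nat.pow_le_pow_right (by norm_num) (by omega))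
    have h3 : n * (n * 3 ^ m) ≤ 2 ^ E := by
      have hn : n ≤ 2 ^ (Nat.log 2 n + 1) := (Nat.lt_pow_succ_log_self (by norm_num) n).le
      calc n * (n * 3 ^ m)
          ≤ 2 ^ (Nat.log 2 n + 1) * (2 ^ (Nat.log 2 n + 1) * 4 ^ m) := by
            gcongr
            norm_num
        _ = 2 ^ (2 * m + 2 * (Nat.log 2 n + 1)) := by
            rw [show (4 : ℕ) = 2 ^ 2 by norm_num, ← pow_mul, ← pow_add, ← pow_add]
            congr 1
            ring
        _ ≤ 2 ^ E := Nat.pow_le_pow_right (by norm_num) (by omega)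
    have hc : Fintype.card U = (q + 1) +
        (Fintype.card (Σ k : Fin (q + 1), Sym (Fin q) (k : ℕ)) + n * (n * 3 ^ m)) := by
      simp only [U, Fintype.card_sum, Fintype.card_prod, Fintype.card_fin, Fintype.card_fun,
        Fintype.card_option, Fintype.card_bool]
    rw [hc, pow_add]
    omega
  obtain ⟨e, he, hlen⟩ := exists_encoding_of_card_le hU
  -- Unbounded tokens receive arbitrary values here; injectivity is needed only on bounded ones.
  let f : Token n q → U
    | .num k => Sum.inl (Fin.ofNat (q + 1) k)
    | .labels M => if h : Multiset.card M < q + 1 then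
        Sum.inr (Sum.inl ⟨⟨Multiset.card M, h⟩, ⟨M, rfl⟩⟩) else Sum.inl 0
    | .msg u v w => Sum.inr (Sum.inr (u, v, fun i => w[(i : ℕ)]?))
  refine ⟨fun x => e (f x), fun x y hx hy hxy => ?_, fun x => hlen _⟩
  have hf := he hxy
  match x, y, hx, hy, hf with
  | .num k, .num l, hx, hy, hf =>
    have h := congrArg Fin.val (Sum.inl_injective hf)
    simp only [Fin.val_ofNat, Token.Bounded] at h hx hy
    rw [Nat.mod_eq_of_lt (by omega), Nat.mod_eq_of_lt (by omega)] at h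
    rw [h]
  | .labels M, .labels N, hx, hy, hf =>
    simp only [f, dif_pos (Nat.lt_succ_of_le hx), dif_pos (Nat.lt_succ_of_le hy)] at hf
    have h := congrArg (fun s : Σ k : Fin (q + 1), Sym (Fin q) (k : ℕ) => (s.2 : Multiset (Fin q)))
      (Sum.inl_injective (Sum.inr_injective hf))
    exact congrArg Token.labels h
  | .msg u v w, .msg u' v' w', hx, hy, hf =>
    have h := Sum.inr_injective (Sum.inr_injective hf)
    simp only [Prod.mk.injEq] at h
    obtain ⟨rfl, rfl, h⟩ := h
    congr 1
    refine List.ext_getElem? fun i => ?_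
    by_cases hi : i < m
    · exact congrFun h ⟨i, hi⟩
    · simp only [Token.Bounded] at hx hy
      rw [List.getElem?_eq_none (by omega), List.getElem?_eq_none (by omega)]
  | .num k, .labels N, hx, hy, hf =>
    simp only [f, dif_pos (Nat.lt_succ_of_le hy)] at hf
    exact absurd hf Sum.inl_ne_inr
  | .labels M, .num k, hx, hy, hf =>
    simp only [f, dif_pos (Nat.lt_succ_of_le hx)] at hf
    exact absurd hf Sum.inr_ne_inl
  | .num k, .msg u v w, hx, hy, hf => exact absurd hf Sum.inl_ne_inr
  | .msg u v w, .num k, hx, hy, hf => exact absurd hf Sum.inr_ne_inl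
  | .labels M, .msg u v w, hx, hy, hf =>
    simp only [f, dif_pos (Nat.lt_succ_of_le hx)] at hf
    exact absurd (Sum.inr_injective hf) Sum.inl_ne_inr
  | .msg u v w, .labels M, hx, hy, hf =>
    simp only [f, dif_pos (Nat.lt_succ_of_le hy)] at hf
    exact absurd (Sum.inr_injective hf) Sum.inr_ne_inl

/-! ### Positions, labels and slots of messages -/

section Messages

variable {n : ℕ}

/-- The messages of an instance, as pairs of a source and a position in the list of the source. -/
abbrev Instance.Message (I : Instance n) : Type := Σ u : Fin n, Fin (I u).length

/-- The destination of a message. -/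
def Instance.dst (I : Instance n) (x : I.Message) : Fin n := ((I x.1).get x.2).1

/-- The content of a message. -/
def Instance.content (I : Instance n) (x : I.Message) : List Bool := ((I x.1).get x.2).2

/-- The number of messages from `u` to `v`. -/
def Instance.mult (I : Instance n) (u v : Fin n) : ℕ := #{j | I.dst ⟨u, j⟩ = v}

/-- The number of messages to `v` from nodes before `u`. -/
def Instance.start (I : Instance n) (v u : Fin n) : ℕ := ∑ w ∈ Iio u, I.mult w v

theorem coe_map_filter_eq_sum {β γ : Type*} (l : List β) (p : β → Prop) [DecidablePred p]
    (f : β → γ) :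
    (((l.filter p).map f : List γ) : Multiset γ) =
      ∑ j : Fin l.length, if p l[j] then {f l[j]} else 0 := by
  induction l with
  | nil => simp
  | cons b l ih =>
    have : ∀ g : Fin (b :: l).length → Multiset γ, ∑ j, g j = g 0 + ∑ j : Fin l.length, g j.succ :=
      fun g => Fin.sum_univ_succ g
    rw [this]
    simp only [Fin.getElem_fin, Fin.val_zero, List.getElem_cons_zero, Fin.val_succ,
      List.getElem_cons_succ] at ih ⊢
    rw [← ih]
    by_cases hb : p b <;> simp [hb, ← Multiset.singleton_add, ← Multiset.cons_coe]

theorem Instance.addressedTo_eq_sum (I : Instance n) (v : Fin n) :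
    I.addressedTo v = ∑ x : I.Message, if I.dst x = v then {(x.1, I.content x)} else 0 := by
  rw [Fintype.sum_sigma]
  exact sum_congr rfl fun u _ => coe_map_filter_eq_sum (I u) (fun p => p.1 = v) _

theorem Instance.card_addressedTo (I : Instance n) (v : Fin n) :
    Multiset.card (I.addressedTo v) = ∑ u, I.mult u v := by
  rw [I.addressedTo_eq_sum, Fintype.sum_sigma, Multiset.card_sum]
  refine sum_congr rfl fun u _ => ?_
  rw [Multiset.card_sum, mult, card_filter]
  exact sum_congr rfl fun j _ => by split_ifs <;> simp

theorem Instance.card_filter_dst (I : Instance n) (v : Fin n) :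
    #{x | I.dst x = v} = Multiset.card (I.addressedTo v) := by
  rw [I.addressedTo_eq_sum, Multiset.card_sum, card_filter]
  exact sum_congr rfl fun j _ => by split_ifs <;> simp

theorem Instance.sum_mult (I : Instance n) (u : Fin n) : ∑ v, I.mult u v = (I u).length := by
  have := Finset.card_eq_sum_card_fiberwise (s := (univ : Finset (Fin (I u).length)))
    (t := univ) (f := fun j => I.dst ⟨u, j⟩) (fun _ _ => mem_coe.2 (mem_univ _))
  simpa [mult] using this.symm

theorem Instance.start_add_mult_le (I : Instance n) {v u u' : Fin n} (h : u < u') :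
    I.start v u + I.mult u v ≤ I.start v u' := by
  rw [start, add_comm, ← sum_insert (f := fun w => I.mult w v) (by simp)]
  refine sum_le_sum_of_subset fun w => ?_
  simp only [mem_insert, mem_Iio]
  rintro (rfl | hw)
  · exact h
  · exact hw.trans h

theorem Instance.start_add_mult_le_card (I : Instance n) (v u : Fin n) :
    I.start v u + I.mult u v ≤ Multiset.card (I.addressedTo v) := by
  rw [start, add_comm, ← sum_insert (f := fun w => I.mult w v) (by simp), I.card_addressedTo]
  exact sum_le_sum_of_subset (subset_univ _)

variable {q : ℕ} [NeZero q]

/-- The position of a message among the messages to its destination. -/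
def Instance.position (I : Instance n) (x : I.Message) : ℕ :=
  I.start (I.dst x) x.1 + fiberRank univ Fin.val (fun j => I.dst ⟨x.1, j⟩) x.2

theorem Instance.position_lt_add (I : Instance n) (x : I.Message) :
    I.position x < I.start (I.dst x) x.1 + I.mult x.1 (I.dst x) :=
  Nat.add_lt_add_left (fiberRank_lt_card (mem_univ _)) _

theorem Instance.position_lt (I : Instance n) (x : I.Message) :
    I.position x < Multiset.card (I.addressedTo (I.dst x)) :=
  (I.position_lt_add x).trans_le (I.start_add_mult_le_card _ _)

theorem Instance.eq_of_position_eq (I : Instance n) {x y : I.Message} (hd : I.dst x = I.dst y)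
    (h : I.position x = I.position y) : x = y := by
  have hx := I.position_lt_add x
  have hy := I.position_lt_add y
  have hx' : I.start (I.dst x) x.1 ≤ I.position x := Nat.le_add_right _ _
  have hy' : I.start (I.dst y) y.1 ≤ I.position y := Nat.le_add_right _ _
  rw [← hd] at hy hy'
  rcases lt_trichotomy x.1 y.1 with hlt | heq | hlt
  · have := I.start_add_mult_le (v := I.dst x) hlt
    omega
  · obtain ⟨u, j⟩ := x
    obtain ⟨u', j'⟩ := y
    dsimp only at heq
    subst heq
    simp only [position, ← hd] at h
    rw [eq_of_fiberRank_eq (f := fun j => I.dst ⟨u, j⟩) Fin.val_injective (mem_univ j)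
      (mem_univ j') hd (Nat.add_left_cancel h)]
  · have := I.start_add_mult_le (v := I.dst x) hlt
    omega

variable (q) in
/-- The position of a message among the messages to its destination, as an element of `Fin q`. -/
def Instance.label (I : Instance n) (x : I.Message) : Fin q := Fin.ofNat q (I.position x)

/-- Admissibility keeps positions below `q`, so the reduction modulo `q` in `label` loses nothing.
-/
theorem Instance.Admissible.eq_of_label_eq {I : Instance n} {m : ℕ} (hI : I.Admissible q m)
    {x y : I.Message} (hd : I.dst x = I.dst y) (h : I.label q x = I.label q y) : x = y := by
  have h' := congrArg Fin.val h
  simp only [label, Fin.val_ofNat] at h'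
  rw [Nat.mod_eq_of_lt ((I.position_lt x).trans_le (hI.2.1 _)),
    Nat.mod_eq_of_lt ((I.position_lt y).trans_le (hI.2.1 _))] at h'
  exact I.eq_of_position_eq hd h'

variable (q) in
/-- The slot of a message. -/
def Instance.slot (I : Instance n) (x : I.Message) : Slot n q :=
  (x.1, I.label q x, fiberRank univ Fin.val (fun j => I.label q ⟨x.1, j⟩) x.2)

/-- Slots name messages by rank within a label rather than by list position, so that the group can
enumerate them knowing only the label multisets. -/
theorem Instance.slot_injective (I : Instance n) : Function.Injective (I.slot q) := by
  rintro ⟨u, j⟩ ⟨u', j'⟩ h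
  simp only [slot, Prod.mk.injEq] at h
  obtain ⟨rfl, hl, hr⟩ := h
  rw [eq_of_fiberRank_eq (f := fun j => I.label q ⟨u, j⟩) Fin.val_injective (mem_univ j)
    (mem_univ j') hl hr]

variable (q) in
/-- The labels of the messages of `u`. -/
def Instance.labels (I : Instance n) (u : Fin n) : Multiset (Fin q) :=
  univ.val.map fun j : Fin (I u).length => I.label q ⟨u, j⟩

theorem Instance.card_labels (I : Instance n) (u : Fin n) :
    Multiset.card (I.labels q u) = (I u).length := by
  simp [labels]

theorem Instance.count_labels (I : Instance n) (u : Fin n) (i : Fin q) :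
    (I.labels q u).count i = #{j | I.label q ⟨u, j⟩ = i} := by
  rw [labels, Multiset.count_map, Finset.card_def, filter_val]
  simp only [eq_comm]

/-- The labels, slots, destinations and contents of the messages of `u` are determined by the list
of `u` and the numbers that `u` learns from the destinations. -/
theorem Instance.exists_corresponding {I I' : Instance n} {u : Fin n} (h : I u = I' u)
    (hs : ∀ v, I.mult u v ≠ 0 → I.start v u = I'.start v u) :
    I.labels q u = I'.labels q u ∧
    ∀ j : Fin (I u).length, ∃ j' : Fin (I' u).length, I.slot q ⟨u, j⟩ = I'.slot q ⟨u, j'⟩ ∧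
      I.dst ⟨u, j⟩ = I'.dst ⟨u, j'⟩ ∧ I.content ⟨u, j⟩ = I'.content ⟨u, j'⟩ := by
  have hs' : ∀ j : Fin (I u).length, I.start (I.dst ⟨u, j⟩) u = I'.start (I.dst ⟨u, j⟩) u :=
    fun j => hs _ (card_ne_zero_of_mem (mem_filter.2 ⟨mem_univ j, rfl⟩))
  let lab (l : List (Fin n × List Bool)) (s : Fin n → ℕ) (j : Fin l.length) : Fin q :=
    Fin.ofNat q (s (l.get j).1 + fiberRank univ Fin.val (fun j => (l.get j).1) j)
  -- Positions have a type depending on the list; with free list variables the equality can be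
  -- substituted.
  have key : ∀ (l l' : List (Fin n × List Bool)) (s s' : Fin n → ℕ), l = l' →
      (∀ j : Fin l.length, s (l.get j).1 = s' (l.get j).1) →
      univ.val.map (lab l s) = univ.val.map (lab l' s') ∧
      ∀ j : Fin l.length, ∃ j' : Fin l'.length,
        ((u, lab l s j, fiberRank univ Fin.val (lab l s) j) : Slot n q) =
          (u, lab l' s' j', fiberRank univ Fin.val (lab l' s') j') ∧
        (l.get j).1 = (l'.get j').1 ∧ (l.get j).2 = (l'.get j').2 := by
    rintro l _ s s' rfl hl
    have : lab l s = lab l s' := funext fun j => by simp only [lab, hl j]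
    rw [this]
    exact ⟨rfl, fun j => ⟨j, rfl, rfl, rfl⟩⟩
  exact key (I u) (I' u) (fun v => I.start v u) (fun v => I'.start v u) h hs'

end Messages

/-! ### Plans computed from the labels of a group -/

section Plans

variable {n q : ℕ}

/-- The slots of the messages with the given labels. -/
def slots (M : Fin n → Multiset (Fin q)) : Finset (Slot n q) :=
  univ.biUnion fun u => univ.biUnion fun i => (range ((M u).count i)).image fun r => (u, i, r)

theorem mem_slots {M : Fin n → Multiset (Fin q)} {p : Slot n q} :
    p ∈ slots M ↔ p.2.2 < (M p.1).count p.2.1 := by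
  obtain ⟨u, i, r⟩ := p
  simp [slots]

theorem card_filter_slots_le (M : Fin n → Multiset (Fin q)) (u : Fin n) :
    #{p ∈ slots M | p.1 = u} ≤ Multiset.card (M u) := by
  calc #{p ∈ slots M | p.1 = u}
      ≤ #((univ : Finset (Fin q)).biUnion fun i =>
          (range ((M u).count i)).image fun r => ((u, i, r) : Slot n q)) := by
        refine card_le_card fun p hp => ?_
        obtain ⟨u', i, r⟩ := p
        simp only [mem_filter, mem_slots] at hp
        obtain ⟨hr, rfl⟩ := hp
        simpa using hr
    _ ≤ ∑ i, (M u).count i := by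
        refine card_biUnion_le.trans (sum_le_sum fun i _ => card_image_le.trans (by simp))
    _ = Multiset.card (M u) := by
        exact Multiset.sum_count_eq_card fun _ _ => mem_univ _

open Classical in
/-- A plan for the slots of a group, determined by the labels. -/
noncomputable def plan (G : Finset (Fin n)) (D : ℕ) (M : Fin n → Multiset (Fin q)) :
    (Slot n q → ℕ × Fin n) × (Slot n q → ℕ × Fin n) :=
  if h : ∃ p : (Slot n q → ℕ × Fin n) × (Slot n q → ℕ × Fin n), IsPlan G D (slots M) p.1 p.2 then
    h.choose
  else (fun x => (0, x.1), fun x => (0, x.1))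

variable [NeZero q] (gr : Fin n → ℕ) (D : ℕ) (I : Instance n)

/-- The members of a group. -/
def group (c : ℕ) : Finset (Fin n) := {w | gr w = c}

variable (q) in
/-- The labels of the messages of the members of a group. -/
def groupLabels (c : ℕ) (u : Fin n) : Multiset (Fin q) := if gr u = c then I.labels q u else 0

variable (q) in
/-- The time slice and the node in which a message is relayed. -/
noncomputable def relay (x : I.Message) : ℕ × Fin n :=
  (plan (group gr (gr x.1)) D (groupLabels q gr I (gr x.1))).1 (I.slot q x)

variable (q) in
/-- The time slice and the node from which a message is sent to its destination. -/
noncomputable def target (x : I.Message) : ℕ × Fin n :=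
  (plan (group gr (gr x.1)) D (groupLabels q gr I (gr x.1))).2 (I.slot q x)

variable {gr D I}

theorem slot_mem_slots {x : I.Message} {c : ℕ} (hc : gr x.1 = c) :
    I.slot q x ∈ slots (groupLabels q gr I c) := by
  rw [mem_slots]
  change _ < (groupLabels q gr I c x.1).count (I.label q x)
  rw [groupLabels, if_pos hc, Instance.count_labels]
  exact fiberRank_lt_card (f := fun j => I.label q ⟨x.1, j⟩) (mem_univ x.2)

theorem isPlan_plan {C m : ℕ} (hC : 0 < C) (hI : I.Admissible q m)
    (hq : ∀ u, q ≤ C * #(group gr (gr u))) (u : Fin n) :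
    IsPlan (group gr (gr u)) (3 * C) (slots (groupLabels q gr I (gr u)))
      (plan (group gr (gr u)) (3 * C) (groupLabels q gr I (gr u))).1
      (plan (group gr (gr u)) (3 * C) (groupLabels q gr I (gr u))).2 := by
  have hex := exists_isPlan (group gr (gr u)) ⟨u, by simp [group]⟩ hC (hq u)
    (slots (groupLabels q gr I (gr u)))
    (fun x hx => by
      by_contra hxG
      simp only [group, mem_filter, mem_univ, true_and] at hxG
      simp [mem_slots, groupLabels, hxG] at hx)
    (fun w => (card_filter_slots_le _ w).trans (by
      rw [groupLabels]
      split_ifs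
      · rw [Instance.card_labels]
        exact hI.1 w
      · simp))
  rw [plan, dif_pos hex]
  exact hex.choose_spec

end Plans

/-! ### The schedule: locality, delivery and load -/

section Routing

variable {n q : ℕ} [NeZero q] (gr : Fin n → ℕ) (D : ℕ) (I : Instance n)

variable (q) in
/-- All groups of `I` have a plan. -/
def Planned : Prop := ∀ u, IsPlan (group gr (gr u)) D (slots (groupLabels q gr I (gr u)))
  (plan (group gr (gr u)) D (groupLabels q gr I (gr u))).1
  (plan (group gr (gr u)) D (groupLabels q gr I (gr u))).2

variable (q) in
/-- The message `x` is forwarded from `u` to `w` in round `t` of the delivery: from its source to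
its relay in the first `D` rounds, from there to its target in the next `D` rounds, and from there
to its destination in the last `D` rounds. -/
def Hop (t : ℕ) (x : I.Message) (u w : Fin n) : Prop :=
  if t < D then x.1 = u ∧ relay q gr D I x = (t, w)
  else if t < 2 * D then (relay q gr D I x).2 = u ∧ target q gr D I x = (t - D, w)
  else target q gr D I x = (t - 2 * D, u) ∧ I.dst x = w

variable (q) in
/-- A message with its source and destination, as a token. -/
def Instance.token (x : I.Message) : Token n q := .msg x.1 (I.dst x) (I.content x)

open Classical in
variable (q) in
/-- What `u` transmits to `w` in round `t`. -/
noncomputable def schedule (t : ℕ) (u w : Fin n) : Option (Token n q) :=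
  match t with
  | 0 => if I.mult u w = 0 then none else some (.num (I.mult u w))
  | 1 => if I.mult w u = 0 then none else some (.num (I.start u w))
  | 2 => if gr u = gr w then some (.labels (I.labels q u)) else none
  | t + 3 => if h : ∃ x, Hop q gr D I t x u w then some (I.token q h.choose) else none

variable {gr D I} {I' : Instance n} {m : ℕ}

theorem Planned.relay_lt (hP : Planned q gr D I) (x : I.Message) : (relay q gr D I x).1 < D :=
  ((hP x.1).relay_mem _ (slot_mem_slots rfl)).1

theorem Planned.group_relay (hP : Planned q gr D I) (x : I.Message) :
    gr (relay q gr D I x).2 = gr x.1 :=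
  (mem_filter.1 ((hP x.1).relay_mem _ (slot_mem_slots rfl)).2).2

theorem Planned.target_lt (hP : Planned q gr D I) (x : I.Message) : (target q gr D I x).1 < D :=
  ((hP x.1).target_mem _ (slot_mem_slots rfl)).1

theorem Planned.group_target (hP : Planned q gr D I) (x : I.Message) :
    gr (target q gr D I x).2 = gr x.1 :=
  (mem_filter.1 ((hP x.1).target_mem _ (slot_mem_slots rfl)).2).2

theorem relay_eq_of_slot_eq {x : I.Message} {x' : I'.Message}
    (hM : groupLabels q gr I (gr x.1) = groupLabels q gr I' (gr x.1))
    (h : I.slot q x = I'.slot q x') : relay q gr D I x = relay q gr D I' x' := by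
  have hx : x.1 = x'.1 := congrArg Prod.fst h
  rw [relay, relay, h, hM, hx]

theorem target_eq_of_slot_eq {x : I.Message} {x' : I'.Message}
    (hM : groupLabels q gr I (gr x.1) = groupLabels q gr I' (gr x.1))
    (h : I.slot q x = I'.slot q x') : target q gr D I x = target q gr D I' x' := by
  have hx : x.1 = x'.1 := congrArg Prod.fst h
  rw [target, target, h, hM, hx]

/-- Tokens do not carry slots. This is how a relay recovers the slot, hence the target, from the
sender and the round of arrival, even across two instances that it cannot tell apart. -/
theorem Planned.slot_eq_of_relay_eq (hP : Planned q gr D I) {x : I.Message} {x' : I'.Message}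
    (hM : groupLabels q gr I (gr x.1) = groupLabels q gr I' (gr x.1)) (hx : x.1 = x'.1)
    (h : relay q gr D I x = relay q gr D I' x') : I.slot q x = I'.slot q x' := by
  refine (hP x.1).relay_inj _ (slot_mem_slots rfl) _ ?_ hx ?_
  · rw [hM]
    exact slot_mem_slots (by rw [hx])
  · rw [relay, relay, ← hx, ← hM] at h
    exact h

/-- A common relay node puts both messages in the same group, hence under the same plan. This
prevents collisions on the second leg. -/
theorem Planned.eq_of_pair_eq (hP : Planned q gr D I) {x x' : I.Message}
    (hr : (relay q gr D I x).2 = (relay q gr D I x').2)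
    (ht : target q gr D I x = target q gr D I x') : x = x' := by
  have hg : gr x.1 = gr x'.1 := by rw [← hP.group_relay, ← hP.group_relay, hr]
  refine I.slot_injective (q := q) ((hP x.1).pair_inj _ (slot_mem_slots rfl) _
    (slot_mem_slots hg.symm) ?_ ?_)
  · rw [relay, relay, ← hg] at hr
    exact hr
  · rw [target, target, ← hg] at ht
    exact ht

/-- A common target forces a common group and label, and labels separate messages to one
destination. This prevents collisions on the last leg. -/
theorem Planned.eq_of_target_eq (hP : Planned q gr D I) (hI : I.Admissible q m) {x x' : I.Message}
    (ht : target q gr D I x = target q gr D I x') (hd : I.dst x = I.dst x') : x = x' := by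
  have hg : gr x.1 = gr x'.1 := by rw [← hP.group_target, ← hP.group_target, ht]
  refine hI.eq_of_label_eq hd ((hP x.1).label_eq _ (slot_mem_slots rfl) _
    (slot_mem_slots hg.symm) ?_)
  rw [target, target, ← hg] at ht
  exact ht

theorem Planned.hop_unique (hP : Planned q gr D I) (hI : I.Admissible q m) {t : ℕ}
    {x x' : I.Message} {u w : Fin n} (h : Hop q gr D I t x u w) (h' : Hop q gr D I t x' u w) :
    x = x' := by
  unfold Hop at h h'
  split_ifs at h h'
  · exact I.slot_injective (q := q)
      (hP.slot_eq_of_relay_eq rfl (h.1.trans h'.1.symm) (h.2.trans h'.2.symm))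
  · exact hP.eq_of_pair_eq (h.1.trans h'.1.symm) (h.2.trans h'.2.symm)
  · exact hP.eq_of_target_eq hI (h.1.trans h'.1.symm) (h.2.trans h'.2.symm)

theorem Planned.hop_relay (hP : Planned q gr D I) (x : I.Message) :
    Hop q gr D I (relay q gr D I x).1 x x.1 (relay q gr D I x).2 := by
  rw [Hop, if_pos (hP.relay_lt x)]
  exact ⟨rfl, rfl⟩

theorem Planned.hop_target (hP : Planned q gr D I) (x : I.Message) :
    Hop q gr D I (D + (target q gr D I x).1) x (relay q gr D I x).2 (target q gr D I x).2 := by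
  have := hP.target_lt x
  rw [Hop, if_neg (by omega), if_pos (by omega), Nat.add_sub_cancel_left]
  exact ⟨rfl, rfl⟩

theorem hop_dst (x : I.Message) :
    Hop q gr D I (2 * D + (target q gr D I x).1) x (target q gr D I x).2 (I.dst x) := by
  rw [Hop, if_neg (by omega), if_neg (by omega), Nat.add_sub_cancel_left]
  exact ⟨rfl, rfl⟩

theorem exists_of_schedule_eq_some {t : ℕ} {u w : Fin n} {a : Token n q}
    (h : schedule q gr D I (t + 3) u w = some a) :
    ∃ x, Hop q gr D I t x u w ∧ I.token q x = a := by
  simp only [schedule] at h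
  split_ifs at h with hex
  exact ⟨_, hex.choose_spec, Option.some_injective _ h⟩

theorem Planned.schedule_eq_some (hP : Planned q gr D I) (hI : I.Admissible q m) {t : ℕ}
    {x : I.Message} {u w : Fin n} (h : Hop q gr D I t x u w) :
    schedule q gr D I (t + 3) u w = some (I.token q x) := by
  have hex : ∃ x, Hop q gr D I t x u w := ⟨x, h⟩
  simp only [schedule]
  rw [dif_pos hex, hP.hop_unique hI hex.choose_spec h]

theorem Instance.mult_congr {u : Fin n} (h : I u = I' u) (v : Fin n) : I.mult u v = I'.mult u v := by
  have key : ∀ l l' : List (Fin n × List Bool), l = l' →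
      #{j : Fin l.length | (l.get j).1 = v} = #{j : Fin l'.length | (l'.get j).1 = v} := by
    rintro l _ rfl
    rfl
  exact key _ _ h

theorem mult_eq_of_schedule_eq {u w : Fin n}
    (h : schedule q gr D I 0 w u = schedule q gr D I' 0 w u) : I.mult w u = I'.mult w u := by
  simp only [schedule] at h
  split_ifs at h with h1 h2 h2
  · rw [h1, h2]
  · simpa using h

theorem start_eq_of_schedule_eq {u v : Fin n} (hu : I u = I' u)
    (h : schedule q gr D I 1 v u = schedule q gr D I' 1 v u) (h0 : I.mult u v ≠ 0) :
    I.start v u = I'.start v u := by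
  simp only [schedule] at h
  rw [if_neg h0, if_neg (by rwa [← I.mult_congr hu])] at h
  simpa using h

theorem groupLabels_eq_of_schedule_eq {u : Fin n}
    (h : ∀ w, schedule q gr D I 2 w u = schedule q gr D I' 2 w u) :
    groupLabels q gr I (gr u) = groupLabels q gr I' (gr u) := by
  funext w
  have hw := h w
  simp only [schedule] at hw
  simp only [groupLabels]
  split_ifs at hw ⊢
  · simpa using hw
  · rfl

/-- What a node transmits is determined by its messages and the transmissions it has received. -/
theorem schedule_eq_some_of_eq (hI : I.Admissible q m) (hI' : I'.Admissible q m)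
    (hP : Planned q gr D I) (hP' : Planned q gr D I') {t : ℕ} {u : Fin n} (hu : I u = I' u)
    (hr : ∀ t' < t, ∀ w, schedule q gr D I t' w u = schedule q gr D I' t' w u) {v : Fin n}
    {a : Token n q} (ha : schedule q gr D I t u v = some a) : schedule q gr D I' t u v = some a := by
  match t with
  | 0 =>
    rw [← ha]
    simp only [schedule, I.mult_congr hu]
  | 1 =>
    have hm : ∀ w, I.mult w u = I'.mult w u := fun w => mult_eq_of_schedule_eq (hr 0 (by omega) w)
    rw [← ha]
    simp only [schedule, Instance.start, hm]
  | 2 =>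
    have hs := fun v => start_eq_of_schedule_eq hu (hr 1 (by omega) v)
    rw [← ha]
    simp only [schedule, (Instance.exists_corresponding (q := q) hu hs).1]
  | t + 3 =>
    have hs := fun v => start_eq_of_schedule_eq hu (hr 1 (by omega) v)
    have hM := groupLabels_eq_of_schedule_eq (hr 2 (by omega))
    obtain ⟨x, hx, rfl⟩ := exists_of_schedule_eq_some ha
    suffices ∃ x' : I'.Message, Hop q gr D I' t x' u v ∧ I'.token q x' = I.token q x by
      obtain ⟨x', hx', hxx⟩ := this
      rw [hP'.schedule_eq_some hI' hx', hxx]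
    unfold Hop at hx ⊢
    split_ifs at hx ⊢ with h1 h2
    · obtain ⟨u, j⟩ := x
      obtain ⟨rfl, hxr⟩ := hx
      obtain ⟨j', hslot, hd, hc⟩ := (Instance.exists_corresponding (q := q) hu hs).2 j
      refine ⟨⟨u, j'⟩, ⟨rfl, ?_⟩, ?_⟩
      · rw [← hxr]
        exact (relay_eq_of_slot_eq hM hslot).symm
      · simp only [Instance.token, hd, hc]
    · obtain ⟨rfl, hxt⟩ := hx
      have hlt := hP.relay_lt x
      -- The relay received `x` in an earlier round, so it receives the same token in `I'`, from a
      -- message with the same slot.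
      have h3 := hP.schedule_eq_some hI (hP.hop_relay x)
      rw [hr _ (by omega)] at h3
      obtain ⟨x', hx', htok⟩ := exists_of_schedule_eq_some h3
      rw [Hop, if_pos hlt] at hx'
      rw [hP.group_relay] at hM
      have hslot := hP.slot_eq_of_relay_eq hM hx'.1.symm hx'.2.symm
      refine ⟨x', ⟨?_, ?_⟩, htok⟩
      · rw [hx'.2]
      · rw [← hxt]
        exact (target_eq_of_slot_eq hM hslot).symm
    · obtain ⟨hxt, rfl⟩ := hx
      have hlt := hP.target_lt x
      -- The arrival slice fixes the sending slice and the token contains the destination, so the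
      -- slot is not needed on the last leg.
      have h3 := hP.schedule_eq_some hI (hP.hop_target x)
      have hu2 : (target q gr D I x).2 = u := by rw [hxt]
      rw [hu2, hr _ (by omega)] at h3
      obtain ⟨x', hx', htok⟩ := exists_of_schedule_eq_some h3
      rw [Hop, if_neg (by omega), if_pos (by omega), Nat.add_sub_cancel_left] at hx'
      refine ⟨x', ⟨?_, ?_⟩, htok⟩
      · rw [hx'.2, hxt]
      · simp only [Instance.token, Token.msg.injEq] at htok
        exact htok.2.1

theorem schedule_congr (hI : I.Admissible q m) (hI' : I'.Admissible q m)
    (hP : Planned q gr D I) (hP' : Planned q gr D I') {t : ℕ} {u : Fin n} (hu : I u = I' u)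
    (hr : ∀ t' < t, ∀ w, schedule q gr D I t' w u = schedule q gr D I' t' w u) (v : Fin n) :
    schedule q gr D I t u v = schedule q gr D I' t u v :=
  Option.ext fun _ => ⟨fun h => schedule_eq_some_of_eq hI hI' hP hP' hu hr h,
    fun h => schedule_eq_some_of_eq hI' hI hP' hP hu.symm (fun t ht w => (hr t ht w).symm) h⟩

/-- The pair (source, content) in a message token. -/
def Token.received : Token n q → Multiset (Fin n × List Bool)
  | msg u _ w => {(u, w)}
  | _ => 0

/-- On the messages to `v`, `target` is injective, so they correspond to the pairs (slice, sender)
that are not silent towards `v` on the last leg. -/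
theorem Planned.addressedTo_eq (hP : Planned q gr D I) (hI : I.Admissible q m) (v : Fin n) :
    I.addressedTo v = ∑ p ∈ range D ×ˢ (univ : Finset (Fin n)),
      (schedule q gr D I (2 * D + p.1 + 3) p.2 v).elim 0 Token.received := by
  rw [I.addressedTo_eq_sum, ← sum_filter]
  have hsub : ({x | I.dst x = v} : Finset I.Message).image (target q gr D I) ⊆
      range D ×ˢ (univ : Finset (Fin n)) := by
    intro p hp
    obtain ⟨x, -, rfl⟩ := mem_image.1 hp
    simpa using hP.target_lt x
  rw [← sum_subset hsub, sum_image]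
  · refine sum_congr rfl fun x hx => ?_
    obtain rfl := (mem_filter.1 hx).2
    rw [hP.schedule_eq_some hI (hop_dst x)]
    rfl
  · intro x hx x' hx' h
    exact hP.eq_of_target_eq hI h
      ((mem_filter.1 (mem_coe.1 hx)).2.trans (mem_filter.1 (mem_coe.1 hx')).2.symm)
  · intro p _ hp
    cases h : schedule q gr D I (2 * D + p.1 + 3) p.2 v with
    | none => rfl
    | some a =>
      obtain ⟨x, hx, -⟩ := exists_of_schedule_eq_some h
      rw [Hop, if_neg (by omega), if_neg (by omega), Nat.add_sub_cancel_left] at hx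
      exact absurd (mem_image.2 ⟨x, by simp [hx.2], hx.1⟩) hp

theorem schedule_bounded (hI : I.Admissible q m) {t : ℕ} {u w : Fin n} {a : Token n q}
    (h : schedule q gr D I t u w = some a) : a.Bounded m := by
  match t with
  | 0 =>
    simp only [schedule] at h
    split_ifs at h
    obtain rfl := Option.some_injective _ h
    exact (Nat.le_add_left _ _).trans ((I.start_add_mult_le_card w u).trans (hI.2.1 w))
  | 1 =>
    simp only [schedule] at h
    split_ifs at h
    obtain rfl := Option.some_injective _ h
    exact (Nat.le_add_right _ _).trans ((I.start_add_mult_le_card u w).trans (hI.2.1 u))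
  | 2 =>
    simp only [schedule] at h
    split_ifs at h
    obtain rfl := Option.some_injective _ h
    exact (I.card_labels u).trans_le (hI.1 u)
  | t + 3 =>
    obtain ⟨x, -, rfl⟩ := exists_of_schedule_eq_some h
    exact hI.2.2 x.1 _ (List.get_mem _ _)

theorem card_filter_ne_zero_le {ι : Type*} [Fintype ι] (f : ι → ℕ) : #{i | f i ≠ 0} ≤ ∑ i, f i := by
  rw [card_filter]
  exact sum_le_sum fun i _ => by split_ifs <;> omega

theorem Planned.card_target_le (hP : Planned q gr D I) (k : ℕ) (u : Fin n) :
    #{x | target q gr D I x = (k, u)} ≤ #(group gr (gr u)) := by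
  refine le_trans ?_ ((hP u).card_le (k, u))
  refine card_le_card_of_injOn (I.slot q) (fun x hx => ?_) I.slot_injective.injOn
  have hx' : target q gr D I x = (k, u) := by simpa using hx
  have hg : gr x.1 = gr u := by rw [← hP.group_target, hx']
  refine mem_coe.2 (mem_filter.2 ⟨slot_mem_slots hg, ?_⟩)
  rw [← hx', target, hg]

/-- The first two rounds use only pairs that share a message, the label round and the first two legs
stay inside a group, and on the last leg a node empties one chunk. -/
theorem Planned.card_send_le (hP : Planned q gr D I) (hI : I.Admissible q m) {L : ℕ} (hqL : q ≤ L)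
    (hL : ∀ u, #(group gr (gr u)) ≤ L) (t : ℕ) (u : Fin n) :
    #{v | (schedule q gr D I t u v).isSome} ≤ L := by
  match t with
  | 0 =>
    refine le_trans (card_le_card fun v hv => ?_) ((card_filter_ne_zero_le fun v => I.mult u v).trans
      ((I.sum_mult u).trans_le ((hI.1 u).trans hqL)))
    simpa [schedule] using hv
  | 1 =>
    refine le_trans (card_le_card fun v hv => ?_) ((card_filter_ne_zero_le fun v => I.mult v u).trans
      ((I.card_addressedTo u).symm.trans_le ((hI.2.1 u).trans hqL)))
    simpa [schedule] using hv
  | 2 =>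
    refine le_trans (card_le_card fun v hv => ?_) (hL u)
    have : gr u = gr v := by simpa [schedule] using hv
    simpa [group] using this.symm
  | t + 3 =>
    have hop : ∀ v, (schedule q gr D I (t + 3) u v).isSome → ∃ x, Hop q gr D I t x u v := by
      intro v hv
      obtain ⟨a, ha⟩ := Option.isSome_iff_exists.1 hv
      obtain ⟨x, hx, -⟩ := exists_of_schedule_eq_some ha
      exact ⟨x, hx⟩
    simp only [Hop] at hop
    split_ifs at hop
    · refine le_trans (card_le_card fun v hv => ?_) (hL u)
      obtain ⟨x, rfl, hx⟩ := hop v (by simpa using hv)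
      have := hP.group_relay x
      rw [hx] at this
      simpa [group] using this
    · refine le_trans (card_le_card fun v hv => ?_) (hL u)
      obtain ⟨x, rfl, hx⟩ := hop v (by simpa using hv)
      have := hP.group_target x
      rw [hx, ← hP.group_relay] at this
      simpa [group] using this
    · refine le_trans (card_le_card (t := ({x | target q gr D I x = (t - 2 * D, u)} :
        Finset I.Message).image I.dst) fun v hv => ?_)
        (card_image_le.trans ((hP.card_target_le _ _).trans (hL u)))
      obtain ⟨x, hx, rfl⟩ := hop v (by simpa using hv)
      exact mem_image_of_mem _ (by simpa using hx)

theorem Planned.card_receive_le (hP : Planned q gr D I) (hI : I.Admissible q m) {L : ℕ}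
    (hqL : q ≤ L) (hL : ∀ u, #(group gr (gr u)) ≤ L) (t : ℕ) (v : Fin n) :
    #{u | (schedule q gr D I t u v).isSome} ≤ L := by
  match t with
  | 0 =>
    refine le_trans (card_le_card fun u hu => ?_) ((card_filter_ne_zero_le fun u => I.mult u v).trans
      ((I.card_addressedTo v).symm.trans_le ((hI.2.1 v).trans hqL)))
    simpa [schedule] using hu
  | 1 =>
    refine le_trans (card_le_card fun u hu => ?_) ((card_filter_ne_zero_le fun u => I.mult v u).trans
      ((I.sum_mult v).trans_le ((hI.1 v).trans hqL)))
    simpa [schedule] using hu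
  | 2 =>
    refine le_trans (card_le_card fun u hu => ?_) (hL v)
    simpa [schedule, group] using hu
  | t + 3 =>
    have hop : ∀ u, (schedule q gr D I (t + 3) u v).isSome → ∃ x, Hop q gr D I t x u v := by
      intro u hu
      obtain ⟨a, ha⟩ := Option.isSome_iff_exists.1 hu
      obtain ⟨x, hx, -⟩ := exists_of_schedule_eq_some ha
      exact ⟨x, hx⟩
    simp only [Hop] at hop
    split_ifs at hop
    · refine le_trans (card_le_card fun u hu => ?_) (hL v)
      obtain ⟨x, rfl, hx⟩ := hop u (by simpa using hu)
      have := hP.group_relay x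
      rw [hx] at this
      simpa [group] using this.symm
    · refine le_trans (card_le_card fun u hu => ?_) (hL v)
      obtain ⟨x, rfl, hx⟩ := hop u (by simpa using hu)
      have := hP.group_target x
      rw [hx, ← hP.group_relay] at this
      simpa [group] using this.symm
    · refine le_trans (card_le_card (t := ({x | I.dst x = v} :
        Finset I.Message).image fun x => (target q gr D I x).2) fun u hu => ?_)
        (card_image_le.trans ((I.card_filter_dst v).trans_le ((hI.2.1 v).trans hqL)))
      obtain ⟨x, hx, rfl⟩ := hop u (by simpa using hu)
      exact mem_image.2 ⟨x, by simp, by rw [hx]⟩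

end Routing

/-! ### Assembly and choice of constants -/

/-- Routing in `9 * C + 3` rounds, if the nodes are partitioned into groups of at most `L` and at
least `q / C` nodes. -/
theorem exists_routing_protocol {n q m L C : ℕ} (hq0 : 0 < q) (hC : 0 < C) (hqL : q ≤ L)
    (gr : Fin n → ℕ) (hL : ∀ u, #(group gr (gr u)) ≤ L)
    (hq : ∀ u, q ≤ C * #(group gr (gr u))) :
    ∃ P : Protocol n, ∀ I : Instance n, I.Admissible q m →
      P.RespectsLimits I (9 * C + 3) L
        ((3 * q + 2 * m + 2 * (Nat.log 2 n + 1) + 2 : ℕ) : ℝ) ∧ P.Delivers I (9 * C + 3) := by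
  have : NeZero q := ⟨hq0.ne'⟩
  obtain ⟨e, he, hlen⟩ := exists_encoding n q m
  have hP : ∀ I : Instance n, I.Admissible q m → Planned q gr (3 * C) I :=
    fun I hI => isPlan_plan hC hI hq
  have hmap : ∀ I I' : Instance n, I.Admissible q m → I'.Admissible q m → ∀ t u v,
      (schedule q gr (3 * C) I t u v).map e = (schedule q gr (3 * C) I' t u v).map e →
      schedule q gr (3 * C) I t u v = schedule q gr (3 * C) I' t u v := by
    intro I I' hI hI' t u v h
    cases h1 : schedule q gr (3 * C) I t u v with
    | none => cases h2 : schedule q gr (3 * C) I' t u v with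
      | none => rfl
      | some b => simp [h1, h2] at h
    | some a => cases h2 : schedule q gr (3 * C) I' t u v with
      | none => simp [h1, h2] at h
      | some b =>
        rw [h1, h2] at h
        rw [he a b (schedule_bounded hI h1) (schedule_bounded hI' h2) (Option.some_injective _ h)]
  obtain ⟨P, hPr⟩ := exists_protocol (fun I => I.Admissible q m) (9 * C + 3)
    (fun I t u v => (schedule q gr (3 * C) I t u v).map e)
    (fun I I' hI hI' t _ u hu hr v => by
      rw [schedule_congr hI hI' (hP I hI) (hP I' hI') hu
        (fun t' ht' w => hmap I I' hI hI' _ _ _ (hr t' ht' w))])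
    (fun I I' hI hI' v _ hr => by
      rw [(hP I hI).addressedTo_eq hI, (hP I' hI').addressedTo_eq hI']
      refine sum_congr rfl fun p hp => ?_
      rw [mem_product, mem_range] at hp
      rw [hmap I I' hI hI' _ _ _ (hr (2 * (3 * C) + p.1 + 3) (by omega) p.2)])
  refine ⟨P, fun I hI => ⟨fun t ht => ?_, (hPr I hI).2⟩⟩
  have htr := (hPr I hI).1 t ht
  simp only [htr, Option.isSome_map]
  refine ⟨fun u => (hP I hI).card_send_le hI hqL hL t u,
    fun v => (hP I hI).card_receive_le hI hqL hL t v, fun u v w hw => ?_⟩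
  obtain ⟨a, -, rfl⟩ := Option.mem_map.1 hw
  rw [hlen]

theorem exists_trivial_protocol (n m : ℕ) : ∃ P : Protocol n, ∀ I : Instance n,
    I.Admissible 0 m → ∀ (R cap : ℕ) (bits : ℝ), P.RespectsLimits I R cap bits ∧ P.Delivers I R := by
  refine ⟨⟨Unit, fun _ _ => (), fun _ _ => none, fun _ _ => (), fun _ => 0⟩,
    fun I hI R cap bits => ⟨fun t _ => ?_, fun v => ?_⟩⟩
  · simp [Protocol.transmitted]
  · exact (Multiset.card_eq_zero.1 (Nat.le_zero.1 (hI.2.1 v))).symm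

theorem encoding_length_le {n q m : ℕ} (hn : 2 ≤ n) {x y : ℝ} (hx : (q : ℝ) ≤ x * Real.log n)
    (hy : (m : ℝ) ≤ y * Real.log n) :
    ((3 * q + 2 * m + 2 * (Nat.log 2 n + 1) + 2 : ℕ) : ℝ) ≤ (3 * x + 2 * y + 12) * Real.log n := by
  -- Since log n > 1/2, the binary logarithm is at most 2 log n, and the additive constant 4 is
  -- absorbed by 8 log n, whence 4 + 8 = 12.
  have h2 : (1 / 2 : ℝ) < Real.log 2 := by linarith [Real.log_two_gt_d9]
  have hlog : Real.log 2 ≤ Real.log n := Real.log_le_log (by norm_num) (by exact_mod_cast hn)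
  have h3 : (Nat.log 2 n : ℝ) * Real.log 2 ≤ Real.log n := by
    rw [← Real.log_pow]
    refine Real.log_le_log (by positivity) ?_
    exact_mod_cast Nat.pow_log_le_self 2 (by omega)
  have h4 : (Nat.log 2 n : ℝ) ≤ 2 * Real.log n := by
    have : (0 : ℝ) ≤ (Nat.log 2 n : ℝ) := Nat.cast_nonneg _
    nlinarith
  push_cast
  linarith

end NCC

theorem theoremt (a A b c : ℝ) (ha : 0 < a) :
    ∃ R K : ℕ, ∀ n α q m : ℕ, 1 ≤ n →
      a * Real.log n ≤ α → (α : ℝ) ≤ A * Real.log n →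
      (q : ℝ) ≤ c * α → (m : ℝ) ≤ b * Real.log n →
      ∃ P : NCC.Protocol n, ∀ I : NCC.Instance n, I.Admissible q m →
        P.RespectsLimits I R (max α q) (K * Real.log n) ∧ P.Delivers I R := by
  obtain ⟨x, hx⟩ := exists_nat_ge (|c| * |A|)
  obtain ⟨y, hy⟩ := exists_nat_ge |b|
  -- Here C = 2(x + 1): the 2 is the loss in the group size, and x + 1 bounds the ratio of q to
  -- min(n, max(α, q)), also when x = 0.
  refine ⟨9 * (2 * (x + 1)) + 3, 3 * x + 2 * y + 12, fun n α q m hn _ hA hc hb => ?_⟩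
  rcases Nat.eq_zero_or_pos q with rfl | hq0
  · obtain ⟨P, hP⟩ := NCC.exists_trivial_protocol n m
    exact ⟨P, fun I hI => hP I hI _ _ _⟩
  have hlog : 0 ≤ Real.log n := Real.log_natCast_nonneg n
  have hqx : (q : ℝ) ≤ x * Real.log n := by
    calc (q : ℝ) ≤ c * α := hc
      _ ≤ |c| * (|A| * Real.log n) := by
          gcongr
          · exact le_abs_self c
          · exact hA.trans (by gcongr; exact le_abs_self A)
      _ = |c| * |A| * Real.log n := by ring
      _ ≤ x * Real.log n := by gcongr
  have hmy : (m : ℝ) ≤ y * Real.log n :=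
    hb.trans (mul_le_mul_of_nonneg_right ((le_abs_self b).trans hy) hlog)
  -- For n = 1 the logarithm vanishes and forces q = 0, a case already treated.
  have hn2 : 2 ≤ n := by
    by_contra hlt
    obtain rfl : n = 1 := by omega
    rw [Nat.cast_one, Real.log_one, mul_zero] at hqx
    exact absurd (show q ≤ 0 by exact_mod_cast hqx) (by omega)
  have hqn : q ≤ x * n := by
    have : (q : ℝ) ≤ x * n := hqx.trans (by
      gcongr
      exact (Real.log_le_sub_one_of_pos (by positivity)).trans (by linarith))
    exact_mod_cast this
  obtain ⟨gr, hgr⟩ := NCC.exists_groups n (max α q) (by omega)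
  obtain ⟨P, hP⟩ := NCC.exists_routing_protocol (m := m) (C := 2 * (x + 1)) hq0 (by omega)
    (le_max_right α q) gr (fun u => (hgr u).1) (fun u => by
      have hmin : q ≤ (x + 1) * min n (max α q) := by
        rcases le_total n (max α q) with h | h
        · rw [min_eq_left h]
          exact hqn.trans (Nat.mul_le_mul_right _ (Nat.le_succ x))
        · rw [min_eq_right h]
          exact (le_max_right α q).trans (Nat.le_mul_of_pos_left _ (Nat.succ_pos x))
      calc q ≤ (x + 1) * min n (max α q) := hmin
        _ ≤ (x + 1) * (2 * (NCC.group gr (gr u)).card) := Nat.mul_le_mul_left _ (hgr u).2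
        _ = 2 * (x + 1) * (NCC.group gr (gr u)).card := by ring)
  refine ⟨P, fun I hI => ⟨fun t ht => ?_, (hP I hI).2⟩⟩
  obtain ⟨h1, h2, h3⟩ := (hP I hI).1 t ht
  refine ⟨h1, h2, fun u v w hw => (h3 u v w hw).trans ?_⟩
  have := NCC.encoding_length_le hn2 hqx hmy
  exact_mod_cast this
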